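/- A simple stochastic game (SSG) is a finite directed graph $G=(V,E)$ whose vertex set is partitioned into max vertices, min vertices, random vertices and a nonempty set of sinks. Every vertex has at least one outgoing arc; the only arc leaving a sink is a loop. Each random vertex $x$ carries a probability distribution $p_x$ whose support is exactly the set of outneighbours of $x$, and each sink $s$ has a value $\mathrm{Val}(s)\in[0,1]$. Strategies are positional: a max (resp. min) strategy chooses an outneighbour of every max (resp. min) vertex. Under a max strategy $\sigma$ and a min strategy $\tau$, a token starting at $x$ follows $\sigma$ at max vertices, $\tau$ at min vertices, and moves according to $p_y$, independently, at each random vertex $y$; $v_{\sigma,\tau}(x)$ is the expected value of the sink that it reaches, a play that reaches no sink having value $0$. A min strategy $\tau$ is a best response to $\sigma$ if $v_{\sigma,\tau}\le v_{\sigma,\tau'}$ pointwise for every min strategy $\tau'$, and best responses of max are defined symmetrically; $(\sigma,\tau)$ is optimal if each strategy is a best response to the other. Let $v_\sigma=\min_\tau v_{\sigma,\tau}$ (pointwise), that is, $v_\sigma=v_{\sigma,\tau}$ for any best response $\tau$ to $\sigma$. For a set $A$ of arcs of $G$, the game $G[A,\sigma]$ is obtained from $G$ by redirecting each arc $e=(x,y)\in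 A$ to a new sink of value $v_\sigma(y)$ (loops of sinks are left unchanged); strategies of $G$ are identified with strategies of $G[A,\sigma]$. In a game $H$, write $\sigma'\succ_H\sigma$ if $v^H_{\sigma'}\ge v^H_\sigma$ pointwise with strict inequality at some vertex, and $\sigma'(x)=\sigma(x)$ for every max vertex $x$ with $v^H_{\sigma'}(x)=v^H_\sigma(x)$. The generic strategy improvement algorithm (GSIA) starts from an arbitrary max strategy $\sigma$; while $\sigma$, taken together with a best response to it, is not optimal in $G$, an iteration chooses an arbitrary set $A$ of arcs of $G$ and an arbitrary $\sigma'$ with $\sigma'\succ_{G[A,\sigma]}\sigma$, and replaces $\sigma$ by $\sigma'$. An instance of GSIA is any rule for making these choices. For a positive integer $q$, a $q$-SSG is an SSG with exactly two sinks, of values $0$ and $1$, such that for every random vertex $x$ there is a positive integer $q_x\le q$ for which all the probabilities $p_x(y)$ are of the form $\ell/q_x$ with $\ell\in\mathbb N$. **Theorem.** Let $q\ge 1$ and let $G$ be a $q$-SSG with $r$ random vertices and $n$ max vertices. Then every instance of GSIA makes at most $n\,q^r$ iterations on $G$. Moreover, in every iteration, which replaces $\sigma$ by $\sigma'$, some max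 vertex $x$ satisfies $v_{\sigma'}(x)\ge v_\sigma(x)+q^{-r}$. -/

import Mathlib

open MeasureTheory ProbabilityTheory

/-- The four classes of vertices of a simple stochastic game. -/
inductive VertexKind where
  | max
  | min
  | random
  | sink

/-- A simple stochastic game on the vertex set `V`. The partition of `V` is given by `kind`.
`prob x` is meaningful only at random vertices `x`, and `val x` only at sinks `x`; their values
elsewhere are never used. -/
structure SSG (V : Type*) where
  kind : V → VertexKind
  Arc : V → V → Prop
  prob : V → PMF V
  val : V → ℝ
  exists_arc : ∀ x, kind x ≠ .sink → ∃ y, Arc x y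
  sink_arc : ∀ x, kind x = .sink → ∀ y, Arc x y ↔ y = x
  exists_sink : ∃ x, kind x = .sink
  prob_pos_iff : ∀ x, kind x = .random → ∀ y, 0 < prob x y ↔ Arc x y
  val_mem : ∀ x, kind x = .sink → val x ∈ Set.Icc (0 : ℝ) 1

namespace SSG

variable {V : Type*}

/-- A positional strategy at the vertices of kind `k`: a choice of an outneighbour at each of
these vertices. -/
def Strategy (G : SSG V) (k : VertexKind) : Type _ :=
  (x : {x : V // G.kind x = k}) → {y : V // G.Arc x y}

abbrev MaxStrategy (G : SSG V) : Type _ := G.Strategy .max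

abbrev MinStrategy (G : SSG V) : Type _ := G.Strategy .min

/-- The law of the next position of the token when it is on `x`. -/
noncomputable def stepPMF (G : SSG V) (σ : G.MaxStrategy) (τ : G.MinStrategy) (x : V) : PMF V :=
  match h : G.kind x with
  | .max => PMF.pure (σ ⟨x, h⟩ : V)
  | .min => PMF.pure (τ ⟨x, h⟩ : V)
  | .random => G.prob x
  | .sink => PMF.pure x

/-- The Markov kernel of `stepPMF`, read on histories of length `t + 1`. -/
noncomputable def stepKernel [MeasurableSpace V] [DiscreteMeasurableSpace V] (G : SSG V)
    (σ : G.MaxStrategy) (τ : G.MinStrategy) (t : ℕ) :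
    Kernel ((_ : Finset.Iic t) → V) V :=
  (⟨fun x => (G.stepPMF σ τ x).toMeasure, .of_discrete⟩ : Kernel V V).comap
    (fun h => h ⟨t, Finset.mem_Iic.2 le_rfl⟩) (measurable_pi_apply _)

instance [MeasurableSpace V] [DiscreteMeasurableSpace V] (G : SSG V)
    (σ : G.MaxStrategy) (τ : G.MinStrategy) (t : ℕ) : IsMarkovKernel (G.stepKernel σ τ t) :=
  ⟨fun h => PMF.toMeasure.isProbabilityMeasure (G.stepPMF σ τ (h ⟨t, Finset.mem_Iic.2 le_rfl⟩))⟩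

/-- The law of the random play `(X₀, X₁, …)` that starts at `x₀` under `(σ, τ)`. -/
noncomputable def playLaw [MeasurableSpace V] [DiscreteMeasurableSpace V] (G : SSG V)
    (σ : G.MaxStrategy) (τ : G.MinStrategy) (x₀ : V) : Measure (ℕ → V) :=
  Kernel.traj (X := fun _ => V) (G.stepKernel σ τ) 0 (fun _ => x₀)

instance [MeasurableSpace V] [DiscreteMeasurableSpace V] (G : SSG V)
    (σ : G.MaxStrategy) (τ : G.MinStrategy) (x₀ : V) : IsProbabilityMeasure (G.playLaw σ τ x₀) := by
  unfold playLaw; infer_instance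

open Classical in
/-- The value of a play: the value of the sink that it reaches, and `0` if it reaches none. -/
noncomputable def playValue (G : SSG V) (X : ℕ → V) : ℝ :=
  if h : ∃ t, G.kind (X t) = .sink then G.val (X (Nat.find h)) else 0

/-- The value vector `v_{σ,τ}`: the expected value of the play. Sets of vertices carry the
discrete σ-algebra. -/
noncomputable def value (G : SSG V) (σ : G.MaxStrategy) (τ : G.MinStrategy) (x : V) : ℝ :=
  letI : MeasurableSpace V := ⊤
  haveI : DiscreteMeasurableSpace V := ⟨fun _ => trivial⟩
  ∫ X, G.playValue X ∂(G.playLaw σ τ x)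

/-- `τ` is a best response to `σ`. -/
def IsMinBestResponse (G : SSG V) (σ : G.MaxStrategy) (τ : G.MinStrategy) : Prop :=
  ∀ τ' : G.MinStrategy, G.value σ τ ≤ G.value σ τ'

/-- `σ` is a best response to `τ`. -/
def IsMaxBestResponse (G : SSG V) (τ : G.MinStrategy) (σ : G.MaxStrategy) : Prop :=
  ∀ σ' : G.MaxStrategy, G.value σ' τ ≤ G.value σ τ

/-- `(σ, τ)` is a pair of optimal strategies: each is a best response to the other. -/
def IsOptimalPair (G : SSG V) (σ : G.MaxStrategy) (τ : G.MinStrategy) : Prop :=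
  G.IsMinBestResponse σ τ ∧ G.IsMaxBestResponse τ σ

/-- The value vector `v_σ` of a max strategy. It equals `v_{σ,τ}` for each best response `τ` to
`σ`, see `maxValue_eq_value`. -/
noncomputable def maxValue (G : SSG V) (σ : G.MaxStrategy) (x : V) : ℝ :=
  ⨅ τ : G.MinStrategy, G.value σ τ x

theorem playValue_mem (G : SSG V) (X : ℕ → V) : G.playValue X ∈ Set.Icc (0 : ℝ) 1 := by
  classical
  unfold playValue
  split_ifs with h
  · exact G.val_mem _ (Nat.find_spec h)
  · simp

theorem value_mem (G : SSG V) (σ : G.MaxStrategy) (τ : G.MinStrategy) (x : V) :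
    G.value σ τ x ∈ Set.Icc (0 : ℝ) 1 := by
  let : MeasurableSpace V := ⊤
  have : DiscreteMeasurableSpace V := ⟨fun _ => trivial⟩
  refine ⟨integral_nonneg fun X => (G.playValue_mem X).1, ?_⟩
  have h : ∫ X, G.playValue X ∂(G.playLaw σ τ x) ≤ ∫ _, (1 : ℝ) ∂(G.playLaw σ τ x) :=
    integral_mono_of_nonneg (.of_forall fun X => (G.playValue_mem X).1) (integrable_const _)
      (.of_forall fun X => (G.playValue_mem X).2)
  exact h.trans (by simp)

instance (G : SSG V) : Nonempty G.MaxStrategy :=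
  ⟨fun x => ⟨_, (G.exists_arc x (by rw [x.2]; exact VertexKind.noConfusion)).choose_spec⟩⟩

instance (G : SSG V) : Nonempty G.MinStrategy :=
  ⟨fun x => ⟨_, (G.exists_arc x (by rw [x.2]; exact VertexKind.noConfusion)).choose_spec⟩⟩

theorem bddBelow_value (G : SSG V) (σ : G.MaxStrategy) (x : V) :
    BddBelow (Set.range fun τ : G.MinStrategy => G.value σ τ x) :=
  ⟨0, by rintro _ ⟨τ, rfl⟩; exact (G.value_mem σ τ x).1⟩

theorem maxValue_mem (G : SSG V) (σ : G.MaxStrategy) (x : V) :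
    G.maxValue σ x ∈ Set.Icc (0 : ℝ) 1 :=
  ⟨le_ciInf fun τ => (G.value_mem σ τ x).1,
    (ciInf_le (G.bddBelow_value σ x) (Classical.arbitrary _)).trans (G.value_mem σ _ x).2⟩

theorem maxValue_eq_value (G : SSG V) (σ : G.MaxStrategy) (τ : G.MinStrategy)
    (h : G.IsMinBestResponse σ τ) : G.maxValue σ = G.value σ τ :=
  funext fun x => le_antisymm (ciInf_le (G.bddBelow_value σ x) τ) (le_ciInf fun τ' => h τ' x)

/-- The strict order `σ' ≻ σ` on max strategies: `v_{σ'} > v_σ` in the pointwise order, and `σ'`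
agrees with `σ` at every max vertex whose value is unchanged. -/
def StrictlyImproves (G : SSG V) (σ' σ : G.MaxStrategy) : Prop :=
  G.maxValue σ < G.maxValue σ' ∧
    ∀ x : {x : V // G.kind x = .max}, G.maxValue σ' x = G.maxValue σ x → σ' x = σ x

open Classical in
/-- The endpoint of the arc `(x, y)` once the arcs of `A` are rerouted to their own new sinks
(the loop of a sink is left as it is). -/
noncomputable def redirect (G : SSG V) (A : Set (V × V)) (x y : V) : V ⊕ A :=
  if h : (x, y) ∈ A ∧ G.kind x ≠ .sink then .inr ⟨(x, y), h.1⟩ else .inl y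

/-- The game `G[A, f]`: each arc `e ∈ A` is rerouted to a new sink of value `f e`. -/
noncomputable def transform (G : SSG V) (A : Set (V × V)) (f : V × V → ℝ)
    (hf : ∀ e, f e ∈ Set.Icc (0 : ℝ) 1) : SSG (V ⊕ A) where
  kind := Sum.elim G.kind fun _ => .sink
  Arc := Sum.elim (fun x z => ∃ y, G.Arc x y ∧ G.redirect A x y = z) (fun e z => z = .inr e)
  prob := Sum.elim (fun x => (G.prob x).map (G.redirect A x)) (fun e => PMF.pure (.inr e))
  val := Sum.elim G.val fun e => f e
  exists_arc := by
    rintro (x | e) h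
    · obtain ⟨y, hy⟩ := G.exists_arc x h
      exact ⟨_, y, hy, rfl⟩
    · exact absurd rfl h
  sink_arc := by
    rintro (x | e) h z
    · have hx : G.kind x = .sink := h
      simp [G.sink_arc x hx, redirect, hx, eq_comm]
    · exact Iff.rfl
  exists_sink := let ⟨x, hx⟩ := G.exists_sink; ⟨.inl x, hx⟩
  prob_pos_iff := by
    rintro (x | e) h z
    · have hx : G.kind x = .random := h
      simp only [Sum.elim_inl, pos_iff_ne_zero, ← PMF.mem_support_iff, PMF.support_map,
        Set.mem_image]
      simp only [PMF.mem_support_iff, ← pos_iff_ne_zero, G.prob_pos_iff x hx]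
    · exact VertexKind.noConfusion h
  val_mem := by
    rintro (x | e) h
    · exact G.val_mem x h
    · exact hf e

/-- The game `G[A, σ]`, in which the new sink of `(x, y) ∈ A` has the value `v_σ(y)`. -/
noncomputable def fixArcs (G : SSG V) (A : Set (V × V)) (σ : G.MaxStrategy) : SSG (V ⊕ A) :=
  G.transform A (fun e => G.maxValue σ e.2) fun e => G.maxValue_mem σ e.2

/-- A max strategy of `G`, seen as a max strategy of `G[A, σ]`. -/
noncomputable def liftStrategy (G : SSG V) (A : Set (V × V)) (σ ρ : G.MaxStrategy) :
    (G.fixArcs A σ).MaxStrategy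
  | ⟨.inl x, hx⟩ => ⟨G.redirect A x (ρ ⟨x, hx⟩), _, (ρ ⟨x, hx⟩).2, rfl⟩
  | ⟨.inr e, _⟩ => ⟨.inr e, rfl⟩

/-- One iteration of the generic strategy improvement algorithm may replace `σ` by `σ'`: the
loop is entered, that is `σ` together with a best response `τ` to `σ` is not optimal, and
`σ' ≻ σ` in `G[A, σ]` for some set `A` of arcs of `G`. -/
def GSIAStep (G : SSG V) (σ σ' : G.MaxStrategy) : Prop :=
  (∃ τ : G.MinStrategy, G.IsMinBestResponse σ τ ∧ ¬ G.IsOptimalPair σ τ) ∧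
    ∃ A : Set (V × V), (∀ e ∈ A, G.Arc e.1 e.2) ∧
      (G.fixArcs A σ).StrictlyImproves (G.liftStrategy A σ σ') (G.liftStrategy A σ σ)

/-- `σ₀, …, σ_N` are the successive max strategies of a (possibly unfinished) execution of an
instance of the generic strategy improvement algorithm, after `N` iterations. -/
def IsGSIARun (G : SSG V) (N : ℕ) (σ : Fin (N + 1) → G.MaxStrategy) : Prop :=
  ∀ i : Fin N, G.GSIAStep (σ i.castSucc) (σ i.succ)

/-- `q`-SSGs: there are exactly two sinks, of values `0` and `1`, and the probabilities at each
random vertex `x` have a common denominator `q_x ≤ q`. -/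
def IsQSSG (G : SSG V) (q : ℕ) : Prop :=
  (∃ s₀ s₁ : V, s₀ ≠ s₁ ∧ (∀ x, G.kind x = .sink ↔ x = s₀ ∨ x = s₁) ∧
    G.val s₀ = 0 ∧ G.val s₁ = 1) ∧
  ∀ x, G.kind x = .random → ∃ qx : ℕ, 0 < qx ∧ qx ≤ q ∧
    ∀ y, ∃ l : ℕ, (G.prob x y).toReal = (l : ℝ) / qx

/-- The number `n` of max vertices. -/
noncomputable def numMax (G : SSG V) : ℕ := Nat.card {x : V // G.kind x = .max}

/-- The number `r` of random vertices. -/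
noncomputable def numRandom (G : SSG V) : ℕ := Nat.card {x : V // G.kind x = .random}

end SSG

/-! Each iteration raises `maxValue` by at least `1 / q ^ r` at some max vertex and lowers it
nowhere. The sum of `maxValue` over the `n` max vertices lies in `[0, n]`, so at most `n * q ^ r`
iterations are possible.

Monotonicity (`GSIAStep.maxValue_lt`) is the chain v_σ ≤ v_σ ≤ v_σ' ≤ v_σ', whose two middle terms
are taken in `G[A, σ]`. The outer inequalities are `maxValue_le_maxValue_fixArcs` and
`maxValue_fixArcs_le_maxValue`. The second is the delicate one, since plays need not reach a sink.

The gap (`IsQSSG.exists_gap`) compares two entries of the single vector v_σ: some max vertex x has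
v_σ(x) < v_σ(σ'(x)). All entries of v_σ share a denominator at most `q ^ r`
(`IsQSSG.exists_common_denominator`), by Cramer's rule for an integer matrix whose determinant is
bounded through `Matrix.det_one_sub_mem_Icc`. Moreover v_σ'(x) = v_σ'(σ'(x)) ≥ v_σ(σ'(x)). -/

/-! ### Finite expectations. -/

/-- The expectation of a real function under a probability mass function. -/
noncomputable def PMF.expect {α : Type*} (p : PMF α) (f : α → ℝ) : ℝ :=
  ∑' y, (p y).toReal * f y

namespace PMF

variable {α β : Type*}

theorem expect_eq_sum [Fintype α] (p : PMF α) (f : α → ℝ) :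
    p.expect f = ∑ y, (p y).toReal * f y := tsum_fintype _

theorem sum_toReal [Fintype α] (p : PMF α) : ∑ y, (p y).toReal = 1 := by
  rw [← ENNReal.toReal_sum fun y _ => p.apply_ne_top y, ← tsum_fintype (L := .unconditional _),
    p.tsum_coe, ENNReal.toReal_one]

theorem integral_toMeasure [Finite α] [MeasurableSpace α] [MeasurableSingletonClass α]
    (p : PMF α) (f : α → ℝ) : ∫ y, f y ∂p.toMeasure = p.expect f := by
  have := Fintype.ofFinite α
  simp [integral_eq_sum, expect_eq_sum]

theorem expect_pure [Finite α] (a : α) (f : α → ℝ) : (PMF.pure a).expect f = f a := by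
  classical
  have := Fintype.ofFinite α
  rw [expect_eq_sum, Finset.sum_eq_single a] <;> simp +contextual

theorem expect_map [Finite α] [Finite β] (p : PMF α) (g : α → β) (f : β → ℝ) :
    (p.map g).expect f = p.expect fun x => f (g x) := by
  let : MeasurableSpace α := ⊤
  let : MeasurableSpace β := ⊤
  rw [← integral_toMeasure, ← integral_toMeasure, ← toMeasure_map g p measurable_from_top,
    integral_map measurable_from_top.aemeasurable
      (measurable_from_top (f := f)).aestronglyMeasurable]

theorem expect_const [Finite α] (p : PMF α) (c : ℝ) : (p.expect fun _ => c) = c := by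
  have := Fintype.ofFinite α
  rw [expect_eq_sum, ← Finset.sum_mul, sum_toReal, one_mul]

theorem expect_mono [Finite α] (p : PMF α) {f g : α → ℝ} (h : ∀ y ∈ p.support, f y ≤ g y) :
    p.expect f ≤ p.expect g := by
  have := Fintype.ofFinite α
  rw [expect_eq_sum, expect_eq_sum]
  refine Finset.sum_le_sum fun y _ => ?_
  by_cases hy : y ∈ p.support
  · exact mul_le_mul_of_nonneg_left (h y hy) ENNReal.toReal_nonneg
  · simp [(p.apply_eq_zero_iff y).2 hy]

theorem expect_congr [Finite α] (p : PMF α) {f g : α → ℝ} (h : ∀ y ∈ p.support, f y = g y) :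
    p.expect f = p.expect g :=
  le_antisymm (p.expect_mono fun y hy => (h y hy).le) (p.expect_mono fun y hy => (h y hy).ge)

theorem expect_add [Finite α] (p : PMF α) (f g : α → ℝ) :
    (p.expect fun y => f y + g y) = p.expect f + p.expect g := by
  have := Fintype.ofFinite α
  simp only [expect_eq_sum, mul_add, Finset.sum_add_distrib]

theorem expect_const_mul [Finite α] (p : PMF α) (c : ℝ) (f : α → ℝ) :
    (p.expect fun y => c * f y) = c * p.expect f := by
  have := Fintype.ofFinite α
  simp only [expect_eq_sum, Finset.mul_sum, mul_left_comm]

theorem eq_of_expect_le [Finite α] (p : PMF α) {f g : α → ℝ} (h : ∀ y ∈ p.support, f y ≤ g y)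
    (hc : p.expect g ≤ p.expect f) {y : α} (hy : y ∈ p.support) : f y = g y := by
  have := Fintype.ofFinite α
  rw [expect_eq_sum, expect_eq_sum] at hc
  have hle : ∀ z ∈ Finset.univ, (p z).toReal * f z ≤ (p z).toReal * g z := fun z _ => by
    by_cases hz : z ∈ p.support
    · exact mul_le_mul_of_nonneg_left (h z hz) ENNReal.toReal_nonneg
    · simp [(p.apply_eq_zero_iff z).2 hz]
  have := (Finset.sum_eq_sum_iff_of_le hle).1 (le_antisymm (Finset.sum_le_sum hle) hc) y
    (Finset.mem_univ y)
  exact mul_left_cancel₀ (ENNReal.toReal_ne_zero.2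
    ⟨(p.mem_support_iff y).1 hy, p.apply_ne_top y⟩) this

theorem continuous_expect [Finite α] (p : PMF α) : Continuous p.expect := by
  have := Fintype.ofFinite α
  have : p.expect = fun f => ∑ y, (p y).toReal * f y := funext fun f => p.expect_eq_sum f
  rw [this]
  fun_prop

end PMF

/-! ### Values of strategy pairs as limits of iterated one-step expectations. -/

namespace SSG

variable {V : Type*}

/-- The one-step expectation of `f` under `(σ, τ)`. -/
noncomputable def step (G : SSG V) (σ : G.MaxStrategy) (τ : G.MinStrategy) (f : V → ℝ) (x : V) :
    ℝ :=
  (G.stepPMF σ τ x).expect f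

open Classical in
/-- The value of the sinks, extended by `0`. -/
noncomputable def sinkVal (G : SSG V) (x : V) : ℝ :=
  if G.kind x = .sink then G.val x else 0

section StepPMF

variable {G : SSG V} {σ : G.MaxStrategy} {τ : G.MinStrategy} {x : V}

theorem stepPMF_max (h : G.kind x = .max) : G.stepPMF σ τ x = PMF.pure (σ ⟨x, h⟩ : V) := by
  unfold stepPMF; split <;> first | rfl | grind

theorem stepPMF_min (h : G.kind x = .min) : G.stepPMF σ τ x = PMF.pure (τ ⟨x, h⟩ : V) := by
  unfold stepPMF; split <;> first | rfl | grind

theorem stepPMF_random (h : G.kind x = .random) : G.stepPMF σ τ x = G.prob x := by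
  unfold stepPMF; split <;> first | rfl | grind

theorem stepPMF_sink (h : G.kind x = .sink) : G.stepPMF σ τ x = PMF.pure x := by
  unfold stepPMF; split <;> first | rfl | grind

theorem stepPMF_congr {τ' : G.MinStrategy} (h : ∀ hx : G.kind x = .min, τ ⟨x, hx⟩ = τ' ⟨x, hx⟩) :
    G.stepPMF σ τ x = G.stepPMF σ τ' x := by
  unfold stepPMF; split <;> simp_all

theorem stepPMF_congr_max {σ' : G.MaxStrategy}
    (h : ∀ hx : G.kind x = .max, σ ⟨x, hx⟩ = σ' ⟨x, hx⟩) :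
    G.stepPMF σ τ x = G.stepPMF σ' τ x := by
  unfold stepPMF; split <;> simp_all

end StepPMF

section Play

variable [MeasurableSpace V] [DiscreteMeasurableSpace V] [Finite V]
  (G : SSG V) (σ : G.MaxStrategy) (τ : G.MinStrategy) (x₀ : V)

/-- The Markov property: the law of the history up to time `t + 1` is that of the history up to `t`
composed with the step kernel. -/
theorem integral_playLaw_succ (f : V → V → ℝ) (t : ℕ) :
    ∫ X, f (X t) (X (t + 1)) ∂(G.playLaw σ τ x₀) =
      ∫ X, G.step σ τ (f (X t)) (X t) ∂(G.playLaw σ τ x₀) := by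
  have hc := Kernel.partialTraj_compProd_eq_map_traj (X := fun _ => V) (κ := G.stepKernel σ τ)
    (Nat.zero_le t) (x₀ := fun _ => x₀)
  let F : ((_ : Finset.Iic t) → V) × V → ℝ := fun p => f (p.1 ⟨t, Finset.mem_Iic.2 le_rfl⟩) p.2
  have hF : Measurable F := .of_discrete
  have h1 : ∫ X, f (X t) (X (t + 1)) ∂(G.playLaw σ τ x₀) =
      ∫ p, F p ∂((G.playLaw σ τ x₀).map
        fun X => (Preorder.frestrictLe (π := fun _ => V) t X, X (t + 1))) := by
    rw [integral_map (by fun_prop) hF.aestronglyMeasurable]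
    rfl
  have h2 : ∫ X, G.step σ τ (f (X t)) (X t) ∂(G.playLaw σ τ x₀) =
      ∫ h : (_ : Finset.Iic t) → V, G.step σ τ (f (h ⟨t, Finset.mem_Iic.2 le_rfl⟩))
        (h ⟨t, Finset.mem_Iic.2 le_rfl⟩)
        ∂((G.playLaw σ τ x₀).map (Preorder.frestrictLe (π := fun _ => V) t)) := by
    rw [integral_map (by fun_prop) (Measurable.of_discrete).aestronglyMeasurable]
    rfl
  rw [h1, h2]
  unfold playLaw
  rw [← hc, Kernel.traj_map_frestrictLe_apply, Measure.integral_compProd .of_finite]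
  refine integral_congr_ae (.of_forall fun h => ?_)
  exact (PMF.integral_toMeasure _ _)

theorem integral_playLaw_eval (f : V → ℝ) (t : ℕ) :
    ∫ X, f (X t) ∂(G.playLaw σ τ x₀) = (G.step σ τ)^[t] f x₀ := by
  induction t generalizing f with
  | zero =>
    have h : ∫ X, f (X 0) ∂(G.playLaw σ τ x₀) =
        ∫ h : (_ : Finset.Iic 0) → V, f (h ⟨0, Finset.mem_Iic.2 le_rfl⟩)
          ∂((G.playLaw σ τ x₀).map (Preorder.frestrictLe (π := fun _ => V) 0)) := by
      rw [integral_map (by fun_prop) (Measurable.of_discrete).aestronglyMeasurable]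
      rfl
    rw [h]
    unfold playLaw
    rw [Kernel.traj_map_frestrictLe_apply, Kernel.partialTraj_self, Kernel.id_apply,
      integral_dirac]
    rfl
  | succ t ih =>
    rw [Function.iterate_succ_apply, ← ih, G.integral_playLaw_succ σ τ x₀ fun _ => f]

theorem ae_sink_absorbing :
    ∀ᵐ X ∂(G.playLaw σ τ x₀), ∀ t, G.kind (X t) = .sink → X (t + 1) = X t := by
  classical
  rw [ae_all_iff]
  intro t
  -- The indicator of leaving a sink; its one-step expectation vanishes.
  let f : V → V → ℝ := fun x y => if G.kind x = .sink ∧ y ≠ x then 1 else 0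
  have h0 : ∫ X, f (X t) (X (t + 1)) ∂(G.playLaw σ τ x₀) = 0 := by
    rw [integral_playLaw_succ]
    refine (integral_congr_ae (.of_forall fun X => ?_)).trans (integral_zero _ _)
    show G.step σ τ (f (X t)) (X t) = 0
    unfold step
    by_cases hx : G.kind (X t) = .sink
    · rw [stepPMF_sink hx, PMF.expect_pure]; simp [f]
    · simp [f, hx, PMF.expect_const]
  have hm : Measurable fun X : ℕ → V => f (X t) (X (t + 1)) :=
    (Measurable.of_discrete (f := fun p : V × V => f p.1 p.2)).comp
      (g := fun p : V × V => f p.1 p.2) (f := fun X : ℕ → V => (X t, X (t + 1)))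
      ((measurable_pi_apply t).prodMk (measurable_pi_apply (t + 1)))
  have hb : ∀ x y, 0 ≤ f x y ∧ f x y ≤ 1 := fun x y => by simp only [f]; split_ifs <;> simp
  have hi : Integrable (fun X : ℕ → V => f (X t) (X (t + 1))) (G.playLaw σ τ x₀) :=
    .of_bound hm.aestronglyMeasurable 1 (.of_forall fun X => by
      rw [Real.norm_of_nonneg (hb _ _).1]; exact (hb _ _).2)
  rw [integral_eq_zero_iff_of_nonneg (fun X => (hb _ _).1) hi] at h0
  filter_upwards [h0] with X hX hs
  by_contra hne
  simp [f, hs, hne] at hX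

end Play

theorem tendsto_sinkVal_playValue (G : SSG V) {X : ℕ → V}
    (hX : ∀ t, G.kind (X t) = .sink → X (t + 1) = X t) :
    Filter.Tendsto (fun t => G.sinkVal (X t)) Filter.atTop (nhds (G.playValue X)) := by
  classical
  by_cases h : ∃ t, G.kind (X t) = .sink
  · have hk : ∀ k, X (Nat.find h + k) = X (Nat.find h) := by
      intro k
      induction k with
      | zero => rfl
      | succ k ih => rw [← add_assoc, hX _ (ih ▸ Nat.find_spec h), ih]
    have hv : G.playValue X = G.sinkVal (X (Nat.find h)) := by
      simp [playValue, sinkVal, h, Nat.find_spec h]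
    rw [hv]
    refine tendsto_const_nhds.congr' ?_
    filter_upwards [Filter.eventually_ge_atTop (Nat.find h)] with t ht
    obtain ⟨k, rfl⟩ := Nat.exists_eq_add_of_le ht
    rw [hk]
  · have hv : G.playValue X = 0 := by simp [playValue, h]
    rw [hv]
    push Not at h
    simp [sinkVal, h]

theorem sinkVal_mem (G : SSG V) (x : V) : G.sinkVal x ∈ Set.Icc (0 : ℝ) 1 := by
  unfold sinkVal
  split_ifs with h
  · exact G.val_mem x h
  · simp

section Value

variable [Finite V] {G : SSG V} {σ : G.MaxStrategy} {τ : G.MinStrategy}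

variable (G σ τ) in
-- Almost surely sinks are absorbing, so `sinkVal` along a play is eventually constant, or
-- constantly `0` if no sink is reached; dominated convergence applies.
theorem tendsto_iterate_step (x : V) :
    Filter.Tendsto (fun t => (G.step σ τ)^[t] G.sinkVal x) Filter.atTop
      (nhds (G.value σ τ x)) := by
  let : MeasurableSpace V := ⊤
  have : DiscreteMeasurableSpace V := ⟨fun _ => trivial⟩
  simp_rw [← integral_playLaw_eval]
  refine tendsto_integral_of_dominated_convergence (fun _ => 1) (fun t => ?_)
    (integrable_const _) (fun t => .of_forall fun X => ?_) ?_
  · exact ((Measurable.of_discrete (f := G.sinkVal)).comp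
      (measurable_pi_apply t)).aestronglyMeasurable
  · rw [Real.norm_of_nonneg (G.sinkVal_mem _).1]; exact (G.sinkVal_mem _).2
  · filter_upwards [G.ae_sink_absorbing σ τ x] with X hX using G.tendsto_sinkVal_playValue hX

theorem step_mono {f g : V → ℝ} (h : f ≤ g) : G.step σ τ f ≤ G.step σ τ g :=
  fun x => (G.stepPMF σ τ x).expect_mono fun y _ => h y

theorem step_sink {x : V} (hx : G.kind x = .sink) (f : V → ℝ) : G.step σ τ f x = f x := by
  rw [step, stepPMF_sink hx, PMF.expect_pure]

variable (G σ τ) in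
theorem step_value : G.step σ τ (G.value σ τ) = G.value σ τ := by
  funext x
  refine tendsto_nhds_unique ?_
    ((Filter.tendsto_add_atTop_iff_nat 1).2 (G.tendsto_iterate_step σ τ x))
  simp_rw [Function.iterate_succ_apply']
  exact ((G.stepPMF σ τ x).continuous_expect.tendsto _).comp
    (tendsto_pi_nhds.2 (G.tendsto_iterate_step σ τ))

theorem value_sink {x : V} (hx : G.kind x = .sink) : G.value σ τ x = G.val x := by
  refine tendsto_nhds_unique (G.tendsto_iterate_step σ τ x) (tendsto_const_nhds.congr fun t => ?_)
  induction t with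
  | zero => simp [sinkVal, hx]
  | succ t ih => rw [Function.iterate_succ_apply', step_sink hx, ih]

/-- The value vector is the least nonnegative superharmonic function that dominates the values of
the sinks. -/
theorem value_le_of_step_le {u : V → ℝ} (h0 : 0 ≤ u) (hs : ∀ x, G.kind x = .sink → G.val x ≤ u x)
    (hu : ∀ x, G.kind x ≠ .sink → G.step σ τ u x ≤ u x) : G.value σ τ ≤ u := by
  intro x
  have hu' : G.step σ τ u ≤ u := fun x => by
    by_cases hx : G.kind x = .sink
    · rw [step_sink hx]
    · exact hu x hx
  refine le_of_tendsto (G.tendsto_iterate_step σ τ x) (.of_forall fun t => ?_)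
  revert x
  change (G.step σ τ)^[t] G.sinkVal ≤ u
  induction t with
  | zero =>
    intro x
    simp only [Function.iterate_zero, id, sinkVal]
    split_ifs with hx
    · exact hs x hx
    · exact h0 x
  | succ t ih => rw [Function.iterate_succ_apply']; exact (step_mono ih).trans hu'

/-- A play trapped in `S` never meets a sink. Formally, the value vector set to `0` on `S` is still
superharmonic, so minimality bounds the value by it. -/
theorem value_eq_zero_of_closed {S : Set V} (hS : ∀ x ∈ S, G.kind x ≠ .sink)
    (hc : ∀ x ∈ S, ∀ y ∈ (G.stepPMF σ τ x).support, y ∈ S) {x : V} (hx : x ∈ S) :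
    G.value σ τ x = 0 := by
  classical
  refine le_antisymm ?_ (G.value_mem σ τ x).1
  have h : G.value σ τ ≤ fun x => if x ∈ S then 0 else G.value σ τ x := by
    refine value_le_of_step_le (fun x => ?_) (fun x hx => ?_) fun x _ => ?_
    · dsimp only [Pi.zero_apply]; split_ifs
      exacts [le_rfl, (G.value_mem σ τ x).1]
    · rw [if_neg fun h => hS x h hx, value_sink hx]
    · by_cases hxS : x ∈ S
      · rw [if_pos hxS, step, (PMF.expect_congr _ fun y hy => if_pos (hc x hxS y hy) :
          _ = PMF.expect _ fun _ => (0 : ℝ)), PMF.expect_const]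
      · rw [if_neg hxS, ← congrFun (G.step_value σ τ) x]
        refine step_mono (fun y => ?_) x
        dsimp only; split_ifs
        exacts [(G.value_mem σ τ y).1, le_rfl]
  simpa [hx] using h x

end Value

end SSG

/-! ### Determinants of `1 - P` for substochastic `P`. -/

namespace Matrix

/-- Gaussian elimination on state `0`: the pivot `1 - P 0 0` lies in `[0, 1]`, and the Schur
complement is `1 - Q` with `Q` again substochastic, being the chain watched only outside state `0`.
If the pivot vanishes, so does its whole row. -/
theorem det_one_sub_mem_Icc_fin {n : ℕ} (P : Matrix (Fin n) (Fin n) ℝ) (h0 : ∀ i j, 0 ≤ P i j)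
    (h1 : ∀ i, ∑ j, P i j ≤ 1) : (1 - P).det ∈ Set.Icc (0 : ℝ) 1 := by
  induction n with
  | zero => simp
  | succ n ih =>
    have hs : P 0 0 + ∑ j : Fin n, P 0 j.succ ≤ 1 := by
      have := h1 0; rwa [Fin.sum_univ_succ] at this
    have hn : 0 ≤ ∑ j : Fin n, P 0 j.succ := Finset.sum_nonneg fun j _ => h0 _ _
    rcases (show P 0 0 ≤ 1 by linarith).eq_or_lt with h | h
    · have hz : ∑ j : Fin n, P 0 j.succ = 0 := by linarith
      rw [Finset.sum_eq_zero_iff_of_nonneg fun j _ => h0 _ _] at hz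
      rw [det_eq_zero_of_row_eq_zero 0]
      · simp
      · intro j
        refine Fin.cases ?_ (fun j => ?_) j
        · simp [h]
        · simp [hz j (Finset.mem_univ j), (Fin.succ_ne_zero j).symm]
    · have ha : 0 < 1 - P 0 0 := by linarith
      let c : Fin (n + 1) → ℝ := Fin.cons 0 fun i => P i.succ 0 / (1 - P 0 0)
      let N : Matrix (Fin (n + 1)) (Fin (n + 1)) ℝ := fun i j => (1 - P) i j + c i * (1 - P) 0 j
      let Q : Matrix (Fin n) (Fin n) ℝ :=
        fun i j => P i.succ j.succ + P i.succ 0 / (1 - P 0 0) * P 0 j.succ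
      have hdet : (1 - P).det = N.det :=
        (det_eq_of_forall_row_eq_smul_add_const (A := N) (B := 1 - P) c 0 rfl fun _ _ => rfl).symm
      have hN : N.submatrix Fin.succ Fin.succ = 1 - Q := by
        ext i j
        change (1 - P) i.succ j.succ + P i.succ 0 / (1 - P 0 0) * (1 - P) 0 j.succ =
          (1 : Matrix _ _ ℝ) i j - (P i.succ j.succ + P i.succ 0 / (1 - P 0 0) * P 0 j.succ)
        simp only [sub_apply, one_apply, Fin.succ_inj, (Fin.succ_ne_zero j).symm, if_false]
        ring
      have hcol : N.det = (1 - P 0 0) * (1 - Q).det := by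
        rw [det_succ_column_zero, Fin.sum_univ_succ, Finset.sum_eq_zero, add_zero]
        · simp only [Fin.succAbove_zero, hN]
          simp [N, c]
        · intro i _
          have : N i.succ 0 = 0 := by
            simp only [N, c, Fin.cons_succ, sub_apply, one_apply, Fin.succ_ne_zero, if_false,
              if_true]
            field_simp
            ring
          simp [this]
      have hQ := ih Q (fun i j => add_nonneg (h0 _ _)
        (mul_nonneg (div_nonneg (h0 _ _) ha.le) (h0 _ _))) fun i => by
          have hi := h1 i.succ
          rw [Fin.sum_univ_succ] at hi
          have : P i.succ 0 / (1 - P 0 0) * ∑ j : Fin n, P 0 j.succ ≤ P i.succ 0 := by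
            rw [div_mul_eq_mul_div, div_le_iff₀ ha]
            exact mul_le_mul_of_nonneg_left (by linarith) (h0 _ _)
          simp only [Q, Finset.sum_add_distrib, ← Finset.mul_sum]
          linarith
      rw [hdet, hcol]
      exact ⟨mul_nonneg ha.le hQ.1, mul_le_one₀ (by linarith [h0 0 0]) hQ.1 hQ.2⟩

/-- If `P` is substochastic, then `det (1 - P)` lies between `0` and `1`. -/
theorem det_one_sub_mem_Icc {ι : Type*} [Fintype ι] [DecidableEq ι] (P : Matrix ι ι ℝ)
    (h0 : ∀ i j, 0 ≤ P i j) (h1 : ∀ i, ∑ j, P i j ≤ 1) : (1 - P).det ∈ Set.Icc (0 : ℝ) 1 := by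
  let e := Fintype.equivFin ι
  have := det_one_sub_mem_Icc_fin (P.submatrix e.symm e.symm) (fun _ _ => h0 _ _) fun i => by
    simpa using (e.symm.sum_comp fun j => P (e.symm i) j).trans_le (h1 (e.symm i))
  rwa [← det_submatrix_equiv_self e.symm, submatrix_sub, Pi.sub_apply, Pi.sub_apply,
    submatrix_one_equiv]

end Matrix

/-! ### A common denominator for the values. -/

namespace SSG

variable {V : Type*}

/-- The values of a `q`-SSG under a pair of strategies have a common denominator that is at most
`q ^ r`. -/
theorem IsQSSG.exists_common_denominator [Finite V] {G : SSG V} {q : ℕ} (hG : G.IsQSSG q)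
    (σ : G.MaxStrategy) (τ : G.MinStrategy) :
    ∃ D : ℕ, 0 < D ∧ D ≤ q ^ G.numRandom ∧
      ∀ x, ∃ a : ℤ, (D : ℝ) * G.value σ τ x = a := by
  classical
  have := Fintype.ofFinite V
  obtain ⟨⟨s₀, s₁, -, hsink, hv0, hv1⟩, hrand⟩ := hG
  have hden : ∀ x, ∃ d : ℕ, 0 < d ∧ (G.kind x = .random → d ≤ q) ∧ (G.kind x ≠ .random → d = 1) ∧
      ∀ y, ∃ l : ℤ, (d : ℝ) * (G.stepPMF σ τ x y).toReal = l := by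
    intro x
    have hpure : ∀ a : V, G.stepPMF σ τ x = PMF.pure a →
        ∀ y, ∃ l : ℤ, ((1 : ℕ) : ℝ) * (G.stepPMF σ τ x y).toReal = l := fun a ha y => by
      rw [ha, PMF.pure_apply]
      split_ifs
      exacts [⟨1, by simp⟩, ⟨0, by simp⟩]
    cases hx : G.kind x with
    | random =>
      obtain ⟨d, hd, hdq, hl⟩ := hrand x hx
      refine ⟨d, hd, fun _ => hdq, fun h => absurd rfl h, fun y => ?_⟩
      obtain ⟨l, hl⟩ := hl y
      refine ⟨l, ?_⟩
      rw [stepPMF_random hx, hl, mul_div_cancel₀ _ (by positivity)]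
      simp
    | max => exact ⟨1, one_pos, by simp, by simp, hpure _ (stepPMF_max hx)⟩
    | min => exact ⟨1, one_pos, by simp, by simp, hpure _ (stepPMF_min hx)⟩
    | sink => exact ⟨1, one_pos, by simp, by simp, hpure _ (stepPMF_sink hx)⟩
  choose d hd0 hdq hd1 hdl using hden
  choose l hl using hdl
  set v := G.value σ τ with hv
  have hvnn : ∀ x, 0 ≤ v x := fun x => (G.value_mem σ τ x).1
  -- Rows outside `act` are replaced by the equations fixing `v x` directly. Treating zero-value
  -- vertices this way removes the closed sets without sinks, which would make `1 - P` singular.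
  let act : V → Prop := fun x => G.kind x ≠ .sink ∧ 0 < v x
  let P : Matrix V V ℝ := fun x y => if act x then (G.stepPMF σ τ x y).toReal else 0
  let M : Matrix V V ℤ := fun x y =>
    (if x = y then (d x : ℤ) else 0) - if act x then l x y else 0
  have hM : M.map (Int.cast : ℤ → ℝ) = Matrix.diagonal (fun x => (d x : ℝ)) * (1 - P) := by
    ext x y
    rw [Matrix.diagonal_mul]
    change (((if x = y then (d x : ℤ) else 0) - if act x then l x y else 0 : ℤ) : ℝ) =
      d x * ((1 : Matrix V V ℝ) x y - if act x then (G.stepPMF σ τ x y).toReal else 0)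
    rw [Matrix.one_apply, mul_sub, mul_ite, mul_ite, hl]
    push_cast
    simp
  have hPv : ∀ w x, act x → (P.mulVec w) x = G.step σ τ w x := fun w x hx => by
    simp [Matrix.mulVec, dotProduct, P, hx, step, PMF.expect_eq_sum]
  have hPv0 : ∀ w x, ¬ act x → (P.mulVec w) x = 0 := fun w x hx => by
    simp [Matrix.mulVec, dotProduct, P, hx]
  have hdetP : (1 - P).det ∈ Set.Icc (0 : ℝ) 1 := by
    refine Matrix.det_one_sub_mem_Icc P (fun x y => ?_) fun x => ?_
    · simp only [P]; split_ifs
      exacts [ENNReal.toReal_nonneg, le_rfl]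
    · by_cases hx : act x
      · simp [P, hx, PMF.sum_toReal]
      · simp [P, hx]
  -- A fixed vector `w` vanishes off `act`, so `v - ε w` is nonnegative for small `ε`, superharmonic
  -- and correct at the sinks. Minimality of `v` gives `w ≤ 0`; applied to `w` and `-w`, this makes
  -- `1 - P` invertible.
  have hker : ∀ w : V → ℝ, P.mulVec w = w → w ≤ 0 := by
    intro w hw
    have hw0 : ∀ x, ¬ act x → w x = 0 := fun x hx => by rw [← hw, hPv0 w x hx]
    obtain ⟨ε, hε, hle⟩ : ∃ ε : ℝ, 0 < ε ∧ ∀ x, ε * w x ≤ v x := by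
      have : ∀ᶠ ε : ℝ in nhdsWithin 0 (Set.Ioi 0), ∀ x, ε * w x ≤ v x := by
        rw [Filter.eventually_all]
        intro x
        by_cases hx : act x
        · have ht : Filter.Tendsto (fun ε : ℝ => ε * w x) (nhdsWithin 0 (Set.Ioi 0)) (nhds 0) := by
            have : Continuous fun ε : ℝ => ε * w x := by fun_prop
            simpa using (this.tendsto 0).mono_left nhdsWithin_le_nhds
          exact (ht.eventually (gt_mem_nhds hx.2)).mono fun ε h => h.le
        · exact .of_forall fun ε => by rw [hw0 x hx, mul_zero]; exact hvnn x
      obtain ⟨ε, h1, h2⟩ := (this.and self_mem_nhdsWithin).exists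
      exact ⟨ε, h2, h1⟩
    have hmin : v ≤ fun x => v x + -ε * w x := by
      refine value_le_of_step_le (fun x => ?_) (fun x hx => ?_) fun x hx => ?_
      · simpa using hle x
      · rw [hw0 x fun h => h.1 hx, mul_zero, add_zero, hv, value_sink hx]
      · have hstep : G.step σ τ (fun x => v x + -ε * w x) x = v x + -ε * G.step σ τ w x := by
          rw [step, PMF.expect_add, PMF.expect_const_mul]
          congr 1
          exact congrFun (G.step_value σ τ) x
        rw [hstep]
        by_cases hxa : act x
        · rw [← hPv w x hxa, hw]
        · have hvx : v x = 0 := le_antisymm (not_lt.1 fun h => hxa ⟨hx, h⟩) (hvnn x)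
          have hsupp : ∀ y ∈ (G.stepPMF σ τ x).support, v y = 0 := fun y hy => by
            refine (PMF.eq_of_expect_le _ (f := fun _ => 0) (fun y _ => hvnn y) ?_ hy).symm
            rw [PMF.expect_const]
            exact ((congrFun (G.step_value σ τ) x).trans hvx).le
          have : G.step σ τ w x = 0 := by
            rw [step, (PMF.expect_congr _ fun y hy => hw0 y fun h => h.2.ne' (hsupp y hy) :
              _ = PMF.expect _ fun _ => (0 : ℝ)), PMF.expect_const]
          rw [this, hw0 x hxa]
    intro x
    have := hmin x
    simp only [neg_mul] at this
    exact nonpos_of_mul_nonpos_right (by linarith) hε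
  have hdetP0 : (1 - P).det ≠ 0 := by
    intro h
    obtain ⟨w, hw, hPw⟩ := Matrix.exists_mulVec_eq_zero_iff.2 h
    rw [Matrix.sub_mulVec, Matrix.one_mulVec, sub_eq_zero] at hPw
    refine hw (le_antisymm (hker w hPw.symm) ?_)
    have := hker (-w) (by rw [Matrix.mulVec_neg, ← hPw])
    simpa using this
  have hdetM : (M.det : ℝ) = (∏ x, (d x : ℝ)) * (1 - P).det := by
    rw [← Matrix.det_diagonal, ← Matrix.det_mul, ← hM]
    exact Int.cast_det M
  have hprod : (∏ x, (d x : ℝ)) ≤ (q : ℝ) ^ G.numRandom := by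
    have : ∏ x, d x ≤ q ^ G.numRandom := by
      rw [numRandom, Nat.card_eq_fintype_card, Fintype.card_subtype, ← Finset.prod_const,
        Finset.prod_filter]
      refine Finset.prod_le_prod' fun x _ => ?_
      split_ifs with hx
      exacts [hdq x hx, (hd1 x hx).le]
    exact_mod_cast this
  have hprod0 : 0 < ∏ x, (d x : ℝ) := Finset.prod_pos fun x _ => by exact_mod_cast hd0 x
  have hpos : 0 < M.det := by
    have : (0 : ℝ) < M.det := hdetM ▸ mul_pos hprod0 (lt_of_le_of_ne hdetP.1 hdetP0.symm)
    exact_mod_cast this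
  have hcast : ((M.det.toNat : ℕ) : ℝ) = (M.det : ℝ) := by
    exact_mod_cast Int.toNat_of_nonneg hpos.le
  refine ⟨M.det.toNat, by simpa using hpos, ?_, fun x => ?_⟩
  · have : ((M.det.toNat : ℕ) : ℝ) ≤ (q : ℝ) ^ G.numRandom := by
      rw [hcast, hdetM]
      exact (mul_le_of_le_one_right hprod0.le hdetP.2).trans hprod
    exact_mod_cast this
  · let b : V → ℤ := fun x => if x = s₁ then 1 else 0
    have hb : (M.map (Int.cast : ℤ → ℝ)).mulVec v = fun x => (b x : ℝ) := by
      rw [hM, ← Matrix.mulVec_mulVec, Matrix.sub_mulVec, Matrix.one_mulVec]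
      funext x
      rw [Matrix.mulVec_diagonal, Pi.sub_apply]
      by_cases hx : G.kind x = .sink
      · rw [hPv0 v x fun h => h.1 hx, hv, value_sink hx, hd1 x (by simp [hx])]
        rcases (hsink x).1 hx with rfl | rfl
        · have : x ≠ s₁ := by rintro rfl; linarith
          simp [b, this, hv0]
        · simp [b, hv1]
      · have hxs : x ≠ s₁ := fun h => hx ((hsink x).2 (.inr h))
        have : v x - P.mulVec v x = 0 := by
          by_cases hxa : act x
          · rw [hPv v x hxa, sub_eq_zero]
            exact (congrFun (G.step_value σ τ) x).symm
          · rw [hPv0 v x hxa, sub_zero]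
            exact le_antisymm (not_lt.1 fun h => hxa ⟨hx, h⟩) (hvnn x)
        simp [this, b, hxs]
    -- Cramer's rule: multiplying `M v = b` by the integer adjugate gives `det M * v`, so `det M` is
    -- the denominator.
    have hadj := congrArg (fun u => (M.map (Int.cast : ℤ → ℝ)).adjugate.mulVec u x) hb
    simp only [Matrix.mulVec_mulVec, Matrix.adjugate_mul, Matrix.smul_mulVec,
      Matrix.one_mulVec] at hadj
    refine ⟨M.adjugate.mulVec b x, ?_⟩
    rw [hcast]
    have h1 : (M.map (Int.cast : ℤ → ℝ)).adjugate = M.adjugate.map (Int.cast : ℤ → ℝ) :=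
      ((Int.castRingHom ℝ).map_adjugate M).symm
    have h2 : (M.map (Int.cast : ℤ → ℝ)).det = (M.det : ℝ) := (Int.cast_det M).symm
    rw [h1, h2] at hadj
    rw [Pi.smul_apply, smul_eq_mul] at hadj
    rw [hadj]
    simp [Matrix.mulVec, dotProduct]

end SSG

/-! ### Best responses of the min player. -/

namespace SSG

variable {V : Type*}

instance [Finite V] (G : SSG V) (k : VertexKind) : Finite (G.Strategy k) := by
  unfold Strategy; infer_instance

theorem maxValue_le_value {G : SSG V} (σ : G.MaxStrategy) (τ : G.MinStrategy) :
    G.maxValue σ ≤ G.value σ τ :=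
  fun x => ciInf_le (G.bddBelow_value σ x) τ

section BestResponse

variable [Finite V] {G : SSG V}

/-- The step at `x` depends on the min strategy only through its choice at `x`, so local choices
glue into one positional strategy. -/
theorem exists_value_le_of_step_le {σ : G.MaxStrategy} {u : V → ℝ} (h0 : 0 ≤ u)
    (hs : ∀ x, G.kind x = .sink → G.val x ≤ u x)
    (hu : ∀ x, G.kind x ≠ .sink → ∃ τ, G.step σ τ u x ≤ u x) : ∃ τ, G.value σ τ ≤ u := by
  have : ∀ x, ∃ τ, G.kind x ≠ .sink → G.step σ τ u x ≤ u x := fun x => by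
    by_cases hx : G.kind x = .sink
    · exact ⟨Classical.arbitrary _, fun h => absurd hx h⟩
    · obtain ⟨τ, hτ⟩ := hu x hx
      exact ⟨τ, fun _ => hτ⟩
  choose τ hτ using this
  refine ⟨fun x => τ x x, value_le_of_step_le h0 hs fun x hx => ?_⟩
  have h : G.stepPMF σ (fun x => τ x x : G.MinStrategy) x = G.stepPMF σ (τ x) x :=
    stepPMF_congr fun _ => rfl
  exact (congrArg (fun p => p.expect u) h).trans_le (hτ x hx)

/-- A minimiser of the total value works: the pointwise minimum of its value with that of any rival
is superharmonic for a glued strategy, which cannot have a smaller total. -/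
theorem exists_isMinBestResponse (σ : G.MaxStrategy) : ∃ τ, G.IsMinBestResponse σ τ := by
  have := Fintype.ofFinite V
  obtain ⟨τ, hτ⟩ := Finite.exists_min fun τ : G.MinStrategy => ∑ x, G.value σ τ x
  refine ⟨τ, fun τ' => ?_⟩
  obtain ⟨ρ, hρ⟩ : ∃ ρ, G.value σ ρ ≤ fun x => min (G.value σ τ x) (G.value σ τ' x) := by
    refine exists_value_le_of_step_le (fun x => le_min (G.value_mem σ τ x).1 (G.value_mem σ τ' x).1)
      (fun x hx => by rw [value_sink hx, value_sink hx, min_self]) fun x _ => ?_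
    rcases le_total (G.value σ τ x) (G.value σ τ' x) with h | h
    · refine ⟨τ, (step_mono (fun y => min_le_left _ _) x).trans ?_⟩
      rw [min_eq_left h]
      exact (congrFun (G.step_value σ τ) x).le
    · refine ⟨τ', (step_mono (fun y => min_le_right _ _) x).trans ?_⟩
      rw [min_eq_right h]
      exact (congrFun (G.step_value σ τ') x).le
  have hle : ∀ x ∈ Finset.univ, G.value σ ρ x ≤ G.value σ τ x :=
    fun x _ => (hρ x).trans (min_le_left _ _)
  have heq := (Finset.sum_eq_sum_iff_of_le hle).1 (le_antisymm (Finset.sum_le_sum hle) (hτ ρ))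
  exact fun x => (heq x (Finset.mem_univ x)).symm.le.trans ((hρ x).trans (min_le_right _ _))

theorem maxValue_sink (σ : G.MaxStrategy) {x : V} (hx : G.kind x = .sink) :
    G.maxValue σ x = G.val x := by
  simp only [maxValue, value_sink hx, ciInf_const]

/-- If switching a best response to `τ` at the single vertex `x` lowered the one-step expectation
strictly, the switched strategy would have the same value vector, by superharmonicity and
optimality, and would violate its fixed-point equation at `x`. -/
theorem maxValue_le_step (σ : G.MaxStrategy) (τ : G.MinStrategy) :
    G.maxValue σ ≤ G.step σ τ (G.maxValue σ) := by
  classical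
  obtain ⟨ρ, hρ⟩ := exists_isMinBestResponse σ
  rw [maxValue_eq_value G σ ρ hρ]
  intro x
  by_contra! h
  let τ' : G.MinStrategy := fun y => if (y : V) = x then τ y else ρ y
  have hx : ∀ f, G.step σ τ' f x = G.step σ τ f x := fun f => by
    rw [step, stepPMF_congr (τ' := τ) fun _ => if_pos rfl]; rfl
  have hle : G.value σ τ' ≤ G.value σ ρ := by
    refine value_le_of_step_le (fun y => (G.value_mem σ ρ y).1)
      (fun y hy => (value_sink hy).ge) fun y _ => ?_
    by_cases hy : y = x
    · subst hy; rw [hx]; exact h.le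
    · rw [step, stepPMF_congr (τ' := ρ) fun _ => if_neg hy]
      exact (congrFun (G.step_value σ ρ) y).le
  have heq := le_antisymm hle (hρ τ')
  have := congrFun (G.step_value σ τ') x
  rw [hx, heq] at this
  exact h.ne this

theorem maxValue_max (σ : G.MaxStrategy) {x : V} (hx : G.kind x = .max) :
    G.maxValue σ x = G.maxValue σ (σ ⟨x, hx⟩ : V) := by
  obtain ⟨τ, hτ⟩ := exists_isMinBestResponse σ
  rw [maxValue_eq_value G σ τ hτ, ← congrFun (G.step_value σ τ) x, step, stepPMF_max hx,
    PMF.expect_pure]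

end BestResponse

/-! ### Comparison of `G` with `G[A, σ]`. -/

section FixArcs

variable {G : SSG V} {A : Set (V × V)} {σ : G.MaxStrategy}

theorem redirect_cases (G : SSG V) (A : Set (V × V)) (x y : V) :
    G.redirect A x y = .inl y ∨ ∃ e : A, G.redirect A x y = .inr e ∧ (e : V × V).2 = y := by
  unfold redirect
  split_ifs with h
  · exact .inr ⟨_, rfl, rfl⟩
  · exact .inl rfl

/-- Lets equality of lifted choices descend to equality of choices in `G`. -/
theorem redirect_injective (G : SSG V) (A : Set (V × V)) (x : V) :
    Function.Injective (G.redirect A x) := by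
  intro y z h
  rcases G.redirect_cases A x y with hy | ⟨e, hy, rfl⟩ <;>
    rcases G.redirect_cases A x z with hz | ⟨e', hz, rfl⟩ <;> rw [hy, hz] at h
  · exact Sum.inl.inj h
  · exact absurd h (by simp)
  · exact absurd h (by simp)
  · rw [Sum.inr.inj h]

theorem stepPMF_fixArcs (ρ : G.MaxStrategy) {τ : G.MinStrategy} {τH : (G.fixArcs A σ).MinStrategy}
    {x : V} (h : ∀ hx : G.kind x = .min, (τH ⟨.inl x, hx⟩ : V ⊕ A) = G.redirect A x (τ ⟨x, hx⟩)) :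
    (G.fixArcs A σ).stepPMF (G.liftStrategy A σ ρ) τH (.inl x) =
      (G.stepPMF ρ τ x).map (G.redirect A x) := by
  cases hx : G.kind x with
  | max =>
    rw [stepPMF_max hx, stepPMF_max (G := G.fixArcs A σ) (x := .inl x) hx, PMF.pure_map]
    rfl
  | min =>
    rw [stepPMF_min hx, stepPMF_min (G := G.fixArcs A σ) (x := .inl x) hx, PMF.pure_map, h hx]
  | random =>
    rw [stepPMF_random hx, stepPMF_random (G := G.fixArcs A σ) (x := .inl x) hx]
    rfl
  | sink =>
    rw [stepPMF_sink hx, stepPMF_sink (G := G.fixArcs A σ) (x := .inl x) hx, PMF.pure_map]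
    simp [redirect, hx]

theorem exists_restrict_minStrategy (τH : (G.fixArcs A σ).MinStrategy) :
    ∃ τ : G.MinStrategy, ∀ x (hx : G.kind x = .min),
      (τH ⟨.inl x, hx⟩ : V ⊕ A) = G.redirect A x (τ ⟨x, hx⟩) := by
  have : ∀ x : {x // G.kind x = .min}, ∃ y : {y // G.Arc x y},
      (τH ⟨.inl x, x.2⟩ : V ⊕ A) = G.redirect A x y := fun x => by
    obtain ⟨y, hy, h⟩ := (τH ⟨.inl x, x.2⟩).2
    exact ⟨⟨y, hy⟩, h.symm⟩
  choose τ hτ using this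
  exact ⟨τ, fun x hx => hτ ⟨x, hx⟩⟩

theorem exists_extend_minStrategy (A : Set (V × V)) (σ : G.MaxStrategy) (τ : G.MinStrategy) :
    ∃ τH : (G.fixArcs A σ).MinStrategy, ∀ x (hx : G.kind x = .min),
      (τH ⟨.inl x, hx⟩ : V ⊕ A) = G.redirect A x (τ ⟨x, hx⟩) :=
  ⟨fun | ⟨.inl x, hx⟩ => ⟨G.redirect A x (τ ⟨x, hx⟩), _, (τ ⟨x, hx⟩).2, rfl⟩
       | ⟨.inr e, _⟩ => ⟨.inr e, rfl⟩,
    fun _ _ => rfl⟩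

variable [Finite V]

theorem maxValue_fixArcs_inr (s : (G.fixArcs A σ).MaxStrategy) (e : A) :
    (G.fixArcs A σ).maxValue s (.inr e) = G.maxValue σ (e : V × V).2 :=
  maxValue_sink (G := G.fixArcs A σ) s rfl

theorem maxValue_le_maxValue_fixArcs (A : Set (V × V)) (σ : G.MaxStrategy) (x : V) :
    G.maxValue σ x ≤ (G.fixArcs A σ).maxValue (G.liftStrategy A σ σ) (.inl x) := by
  refine le_ciInf fun τH => ?_
  obtain ⟨τ, hτ⟩ := exists_restrict_minStrategy τH
  obtain ⟨ρ, hρ⟩ := exists_isMinBestResponse σ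
  set u := (G.fixArcs A σ).value (G.liftStrategy A σ σ) τH with hu
  have hv := maxValue_eq_value G σ ρ hρ
  -- The minimum of `u` and v_σ is superharmonic in `G`: where `u` is smaller, follow `τ`, as a
  -- redirected arc pays v_σ of its endpoint; elsewhere follow the best response `ρ`.
  obtain ⟨τ', hτ'⟩ : ∃ τ', G.value σ τ' ≤ fun x => min (u (.inl x)) (G.maxValue σ x) := by
    refine exists_value_le_of_step_le
      (fun x => le_min ((G.fixArcs A σ).value_mem _ _ _).1 (G.maxValue_mem σ x).1)
      (fun x hx => ?_) fun x _ => ?_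
    · rw [maxValue_sink σ hx, hu, value_sink (G := G.fixArcs A σ) (x := .inl x) hx]
      exact (min_self _).ge
    rcases le_total (u (.inl x)) (G.maxValue σ x) with h | h
    · refine ⟨τ, ?_⟩
      rw [min_eq_left h, hu, ← congrFun ((G.fixArcs A σ).step_value _ _) (.inl x), step, step,
        stepPMF_fixArcs σ (hτ x), PMF.expect_map]
      refine PMF.expect_mono _ fun y _ => ?_
      rcases G.redirect_cases A x y with hy | ⟨e, hy, rfl⟩ <;> rw [hy]
      · exact min_le_left _ _
      · rw [value_sink (G := G.fixArcs A σ) (x := .inr e) rfl]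
        exact min_le_right _ _
    · refine ⟨ρ, (step_mono (fun y => min_le_right _ _) x).trans ?_⟩
      rw [min_eq_right h, hv]
      exact (congrFun (G.step_value σ ρ) x).le
  exact (maxValue_le_value σ τ' x).trans ((hτ' x).trans (min_le_left _ _))

/-- A maximum principle for `W - u`. Where a positive maximum is attained, plays under `σ'` and `τ`
are trapped away from sinks, and both clauses of `StrictlyImproves` serve to exclude this. -/
theorem maxValue_fixArcs_le_maxValue {σ' : G.MaxStrategy}
    (h : (G.fixArcs A σ).StrictlyImproves (G.liftStrategy A σ σ') (G.liftStrategy A σ σ)) (x : V) :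
    (G.fixArcs A σ).maxValue (G.liftStrategy A σ σ') (.inl x) ≤ G.maxValue σ' x := by
  refine le_ciInf fun τ => ?_
  by_contra! hlt
  obtain ⟨τH, hτH⟩ := exists_extend_minStrategy A σ τ
  set W := (G.fixArcs A σ).maxValue (G.liftStrategy A σ σ') with hW
  set u := G.value σ' τ with hu
  set v := G.maxValue σ with hv
  have hvw₀ : ∀ y, v y ≤ (G.fixArcs A σ).maxValue (G.liftStrategy A σ σ) (.inl y) :=
    maxValue_le_maxValue_fixArcs A σ
  have hvw : ∀ y, v y ≤ W (.inl y) := fun y => (hvw₀ y).trans (h.1.le _)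
  have hred : ∀ y z, W (G.redirect A y z) ≤ W (.inl z) := fun y z => by
    rcases G.redirect_cases A y z with hz | ⟨e, hz, rfl⟩ <;> rw [hz]
    rw [hW, maxValue_fixArcs_inr]
    exact hvw _
  have : Nonempty V := ⟨x⟩
  obtain ⟨x₀, hx₀⟩ := Finite.exists_max fun y => W (.inl y) - u y
  set δ := W (.inl x₀) - u x₀ with hδ
  have hδ0 : 0 < δ := by linarith [hx₀ x]
  let S : Set V := {y | W (.inl y) = u y + δ}
  have hx₀S : x₀ ∈ S := by simp [S, hδ]
  have hSsink : ∀ y ∈ S, G.kind y ≠ .sink := fun y hy hs => by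
    have h1 : W (.inl y) = G.val y :=
      maxValue_sink (G := G.fixArcs A σ) _ (x := .inl y) hs
    have h2 : u y = G.val y := value_sink hs
    have h3 : W (.inl y) = u y + δ := hy
    linarith
  have hSred : ∀ y ∈ S, ∀ z ∈ (G.stepPMF σ' τ y).support,
      W (G.redirect A y z) = u z + δ := by
    intro y hy z hz
    refine PMF.eq_of_expect_le (G.stepPMF σ' τ y) (f := fun z => W (G.redirect A y z))
      (g := fun z => u z + δ) (fun z _ => ?_) ?_ hz
    · have := hx₀ z
      have := hred y z
      change _ ≤ u z + δ
      linarith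
    · rw [PMF.expect_add, PMF.expect_const]
      have h1 : (G.stepPMF σ' τ y).expect u = u y := congrFun (G.step_value σ' τ) y
      have h2 : W (.inl y) = u y + δ := hy
      have h3 := maxValue_le_step (G.liftStrategy A σ σ') τH (.inl y)
      rw [step, stepPMF_fixArcs σ' (hτH y), PMF.expect_map] at h3
      rw [h1, ← h2]
      exact h3
  -- Subharmonicity of `W` and `W (redirect y z) ≤ W z` force the maximal difference `δ` to
  -- propagate to every successor.
  have hSclosed : ∀ y ∈ S, ∀ z ∈ (G.stepPMF σ' τ y).support, z ∈ S := by
    intro y hy z hz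
    have h1 := hSred y hy z hz
    have h2 := hx₀ z
    have h3 := hred y z
    change W (.inl z) = u z + δ
    linarith
  have huS : ∀ y ∈ S, u y = 0 := fun y hy => value_eq_zero_of_closed hSsink hSclosed hy
  have hwS : ∀ y ∈ S, W (.inl y) = δ := fun y hy => by
    have h1 : W (.inl y) = u y + δ := hy
    rw [h1, huS y hy, zero_add]
  -- If v_σ attains `δ` on `S`, then where it does, `σ` and `σ'` have equal values in `G[A, σ]` and
  -- hence make equal choices. That subset is closed under `σ` and `τ`, so v_σ would be `0` there.
  by_cases hex : ∃ z ∈ S, v z = δ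
  · obtain ⟨z, hzS, hz⟩ := hex
    have hz0 : G.value σ τ z = 0 := by
      refine value_eq_zero_of_closed (S := {z | z ∈ S ∧ v z = δ}) (fun y hy => hSsink y hy.1) ?_
        ⟨hzS, hz⟩
      rintro y ⟨hyS, hy⟩ y' hy'
      have hvy : (G.fixArcs A σ).maxValue (G.liftStrategy A σ σ) (.inl y) = δ :=
        le_antisymm ((h.1.le _).trans_eq (hwS y hyS)) (hy ▸ hvw₀ y)
      have hσ : ∀ hx : G.kind y = .max, σ ⟨y, hx⟩ = σ' ⟨y, hx⟩ := fun hx => by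
        have := h.2 ⟨.inl y, hx⟩ ((hwS y hyS).trans hvy.symm)
        exact Subtype.ext (G.redirect_injective A y (congrArg Subtype.val this).symm)
      have hstep : G.stepPMF σ τ y = G.stepPMF σ' τ y := stepPMF_congr_max hσ
      have hsub : ∀ z ∈ (G.stepPMF σ τ y).support, z ∈ S :=
        fun z hz => hSclosed y hyS z (hstep ▸ hz)
      refine ⟨hsub y' hy', ?_⟩
      refine PMF.eq_of_expect_le (G.stepPMF σ τ y) (f := v) (g := fun _ => δ)
        (fun z hz => (hvw z).trans_eq (hwS z (hsub z hz))) ?_ hy'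
      rw [PMF.expect_const, ← hy]
      exact maxValue_le_step σ τ y
    have := maxValue_le_value σ τ z
    rw [hz0] at this
    linarith
  -- Otherwise no arc played inside `S` is redirected, since its new sink would have value `δ`. So
  -- `S` is closed in `G[A, σ]` too, contradicting `W = δ > 0` there.
  · push Not at hex
    have h0 : (G.fixArcs A σ).value (G.liftStrategy A σ σ') τH (.inl x₀) = 0 := by
      refine value_eq_zero_of_closed (G := G.fixArcs A σ) (S := Sum.inl '' S) ?_ ?_ ⟨x₀, hx₀S, rfl⟩
      · rintro _ ⟨y, hy, rfl⟩
        exact hSsink y hy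
      · rintro _ ⟨y, hy, rfl⟩ z hz
        rw [stepPMF_fixArcs σ' (hτH y), PMF.support_map] at hz
        obtain ⟨y', hy', rfl⟩ := hz
        have hy'S := hSclosed y hy y' hy'
        rcases G.redirect_cases A y y' with hr | ⟨e, hr, rfl⟩
        · exact ⟨y', hy'S, hr.symm⟩
        · have h1 := hSred y hy _ hy'
          rw [hr, hW, maxValue_fixArcs_inr, huS _ hy'S, zero_add] at h1
          exact absurd h1 (hex _ hy'S)
    have h1 := maxValue_le_value (G.liftStrategy A σ σ') τH (.inl x₀)
    rw [h0] at h1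
    have h2 := hwS x₀ hx₀S
    linarith

/-- The new sinks have the same value under both strategies, so the strict increase occurs at a
vertex of `G`. -/
theorem GSIAStep.maxValue_lt {σ' : G.MaxStrategy} (h : G.GSIAStep σ σ') :
    G.maxValue σ < G.maxValue σ' := by
  obtain ⟨-, A, -, hA⟩ := h
  have hle : ∀ x, G.maxValue σ x ≤ G.maxValue σ' x := fun x =>
    (maxValue_le_maxValue_fixArcs A σ x).trans
      ((hA.1.le _).trans (maxValue_fixArcs_le_maxValue hA x))
  obtain ⟨-, x | e, hx⟩ := Pi.lt_def.1 hA.1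
  · exact Pi.lt_def.2 ⟨hle, x, (maxValue_le_maxValue_fixArcs A σ x).trans_lt
      (hx.trans_le (maxValue_fixArcs_le_maxValue hA x))⟩
  · rw [maxValue_fixArcs_inr, maxValue_fixArcs_inr] at hx
    exact absurd hx (lt_irrefl _)

end FixArcs

/-! ### The quantitative gain of one iteration. -/

section Gap

variable [Finite V] {G : SSG V} {σ σ' : G.MaxStrategy}

/-- A strategy with larger values uses an arc that is improving for the values of the old one. -/
theorem exists_improving_arc (h : G.maxValue σ < G.maxValue σ') :
    ∃ x : {x : V // G.kind x = .max}, G.maxValue σ x < G.maxValue σ (σ' x : V) := by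
  -- Without such an arc, v_σ is superharmonic under `σ'` and a best response to `σ`, hence bounds
  -- v_σ' from above.
  by_contra! hno
  obtain ⟨τ, hτ⟩ := exists_isMinBestResponse σ
  refine h.not_ge ((maxValue_le_value σ' τ).trans ?_)
  refine value_le_of_step_le (fun x => (G.maxValue_mem σ x).1)
    (fun x hx => (maxValue_sink σ hx).ge) fun x _ => ?_
  by_cases hx : G.kind x = .max
  · rw [step, stepPMF_max hx, PMF.expect_pure]
    exact hno ⟨x, hx⟩
  · rw [maxValue_eq_value G σ τ hτ, step, stepPMF_congr_max (σ' := σ) fun h => absurd h hx]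
    exact (congrFun (G.step_value σ τ) x).le

theorem IsQSSG.exists_gap {q : ℕ} (hG : G.IsQSSG q)
    (h : G.maxValue σ < G.maxValue σ') :
    ∃ x, G.kind x = .max ∧
      G.maxValue σ x + 1 / (q : ℝ) ^ G.numRandom ≤ G.maxValue σ' x := by
  obtain ⟨⟨x, hx⟩, hlt⟩ := exists_improving_arc h
  refine ⟨x, hx, ?_⟩
  rw [maxValue_max σ' hx]
  refine le_trans ?_ (h.le _)
  obtain ⟨τ, hτ⟩ := exists_isMinBestResponse σ
  obtain ⟨D, hD0, hDq, hD⟩ := hG.exists_common_denominator σ τ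
  rw [← maxValue_eq_value G σ τ hτ] at hD
  obtain ⟨a, ha⟩ := hD x
  obtain ⟨b, hb⟩ := hD (σ' ⟨x, hx⟩ : V)
  have hD0' : (0 : ℝ) < D := by exact_mod_cast hD0
  -- Both numerators are over the same `D`, so a strict inequality costs a full `1 / D`;
  -- denominators for σ and σ' separately would give only a product bound.
  have hab : a + 1 ≤ b := by
    have : (a : ℝ) < b := by rw [← ha, ← hb]; exact mul_lt_mul_of_pos_left hlt hD0'
    exact_mod_cast this
  have hab' : (D : ℝ) * G.maxValue σ x + 1 ≤ D * G.maxValue σ (σ' ⟨x, hx⟩ : V) := by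
    rw [ha, hb]; exact_mod_cast hab
  have h1 : 1 / (q : ℝ) ^ G.numRandom ≤ 1 / D :=
    one_div_le_one_div_of_le hD0' (by exact_mod_cast hDq)
  have h2 : G.maxValue σ x + 1 / D ≤ G.maxValue σ (σ' ⟨x, hx⟩ : V) := by
    refine le_of_mul_le_mul_left ?_ hD0'
    rw [mul_add, mul_one_div_cancel hD0'.ne']
    exact hab'
  linarith

end Gap

end SSG

/-! ### Counting iterations. -/

theorem mainTheorem3 {V : Type*} [Finite V] (G : SSG V) (q : ℕ) (hq : 0 < q) (hG : G.IsQSSG q)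
    (N : ℕ) (σ : Fin (N + 1) → G.MaxStrategy) (hσ : G.IsGSIARun N σ) :
    (∀ i : Fin N, ∃ x : V, G.kind x = .max ∧
      G.maxValue (σ i.castSucc) x + 1 / (q : ℝ) ^ G.numRandom ≤ G.maxValue (σ i.succ) x) ∧
    N ≤ G.numMax * q ^ G.numRandom := by
  have hgap : ∀ i : Fin N, ∃ x : V, G.kind x = .max ∧
      G.maxValue (σ i.castSucc) x + 1 / (q : ℝ) ^ G.numRandom ≤ G.maxValue (σ i.succ) x :=
    fun i => hG.exists_gap (hσ i).maxValue_lt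
  refine ⟨hgap, ?_⟩
  have := Fintype.ofFinite {x : V // G.kind x = .max}
  have hQ : (0 : ℝ) < (q : ℝ) ^ G.numRandom := by positivity
  -- The potential is the sum of `maxValue` over max vertices; it starts nonnegative and gains at
  -- least `1 / q ^ r` per iteration.
  have hsum : ∀ i : Fin (N + 1), (i : ℝ) / (q : ℝ) ^ G.numRandom ≤
      ∑ x : {x : V // G.kind x = .max}, G.maxValue (σ i) x := by
    intro i
    induction i using Fin.induction with
    | zero => simpa using Finset.sum_nonneg fun x _ => (G.maxValue_mem (σ 0) _).1
    | succ i ih =>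
      obtain ⟨x, hx, hle⟩ := hgap i
      have h1 : ∑ y : {x : V // G.kind x = .max}, G.maxValue (σ i.castSucc) y +
          1 / (q : ℝ) ^ G.numRandom ≤
          ∑ y : {x : V // G.kind x = .max}, G.maxValue (σ i.succ) y := by
        classical
        rw [← Finset.add_sum_erase _ _ (Finset.mem_univ (⟨x, hx⟩ : {x : V // G.kind x = .max})),
          ← Finset.add_sum_erase _ _ (Finset.mem_univ (⟨x, hx⟩ : {x : V // G.kind x = .max}))]
        have h2 := Finset.sum_le_sum fun (y : {x : V // G.kind x = .max})
          (_ : y ∈ Finset.univ.erase ⟨x, hx⟩) => (hσ i).maxValue_lt.le (y : V)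
        linarith
      have h3 : ((i.succ : Fin (N + 1)) : ℝ) / (q : ℝ) ^ G.numRandom =
          (i.castSucc : Fin (N + 1)) / (q : ℝ) ^ G.numRandom + 1 / (q : ℝ) ^ G.numRandom := by
        simp [add_div]
      linarith
  have hlast := (hsum (Fin.last N)).trans
    (Finset.sum_le_sum fun x _ => (G.maxValue_mem (σ (Fin.last N)) (x : V)).2)
  simp only [Fin.val_last, Finset.sum_const, Finset.card_univ, nsmul_eq_mul, mul_one] at hlast
  rw [div_le_iff₀ hQ, ← Nat.card_eq_fintype_card] at hlast
  exact_mod_cast hlast
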